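/- **Setting.** Let $d,n\ge 0$. The group $O(d)$ acts on $\mathbb{R}^d$, and $O(1,d)$ (all $A$ with $A^{\top}\eta A=\eta$, $\eta=\mathrm{diag}(1,-1,\dots,-1)$) acts on $\mathbb{R}^{1+d}$, which carries the Minkowski form $\langle x,y\rangle=x^{\top}\eta y$. Write $D=d$ for $O(d)$ and $D=1+d$ for $O(1,d)$. A function $h:(\mathbb{R}^{D})^n\to\mathbb{R}^D$ is equivariant if $h(AX_1,\dots,AX_n)=A\,h(X_1,\dots,X_n)$ for all $A$ in the group and all $X_1,\dots,X_n$. **Model.** Let $\mathrm{inv}(x)=\|x\|$ (Euclidean norm) for $O(d)$ and $\mathrm{inv}(x)=\langle x,x\rangle$ for $O(1,d)$. A G-RepsNet model (with features of types $T_0$, scalars, and $T_1$, vectors in $\mathbb{R}^D$) is a finite composition of layers. A layer takes scalars $s_1,\dots,s_a$ and vectors $v_1,\dots,v_b$. Its $T_0$-layer computes $Y=\mathrm{MLP}(s_1,\dots,s_a,\mathrm{inv}(v_1),\dots,\mathrm{inv}(v_b))$ with a ReLU multilayer perceptron of any depth and widths; $Y$ is the scalar output. Its vector output is either $Wv$,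 or $W_2\widetilde H$ with $\widetilde H_i=H_i\,Y_i/\mathrm{inv}(H_i)$ and $H=W_1v$ having as many channels as $Y$ (where $\widetilde H_i=0$ if $\mathrm{inv}(H_i)=0$); here $W,W_1,W_2$ are real matrices that form linear combinations of vectors. The models below have $n$ input vectors $X=(X_1,\dots,X_n)$ and one output vector. **Theorem.** 1. Let $h:(\mathbb{R}^d)^n\to\mathbb{R}^d$ be $O(d)$-equivariant and $\varepsilon>0$. (a) If $K\subset(\mathbb{R}^d)^n$ is compact and $h$ is continuous on $K$, there is a G-RepsNet model $N$ with $\|N(X)-h(X)\|<\varepsilon$ for all $X\in K$. (b) If $h$ is Borel measurable and $\mu$ is a finite Borel measure on $(\mathbb{R}^d)^n$, there is a G-RepsNet model $N$ with $\mu\{X:\|N(X)-h(X)\|\ge\varepsilon\}<\varepsilon$. 2. Let $\Omega\subset(\mathbb{R}^{1+d})^n$ be the set of those $X$ for which the Minkowski form is nondegenerate on $\mathrm{span}(X_1,\dots,X_n)$. Lebesgue-almost every $X$ lies in $\Omega$. Let $h:(\mathbb{R}^{1+d})^n\to\mathbb{R}^{1+d}$ be $O(1,d)$-equivariant and $\varepsilon>0$.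 (a) If $K\subset\Omega$ is compact and $h$ is continuous on $K$, there is a G-RepsNet model $N$ with $\|N(X)-h(X)\|<\varepsilon$ for all $X\in K$. (b) If $h$ is Borel measurable and $\mu$ is a finite Borel measure with $\mu(\Omega^c)=0$ (for instance one that is absolutely continuous with respect to Lebesgue measure), there is a G-RepsNet model $N$ with $\mu\{X:\|N(X)-h(X)\|\ge\varepsilon\}<\varepsilon$. -/

import Mathlib

noncomputable section

namespace GReps

/-! ### Vectors, groups and equivariance -/

/-- Column vectors `ℝ^D`, with the Euclidean norm and topology. -/
abbrev Vec (D : ℕ) : Type := EuclideanSpace ℝ (Fin D)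

/-- Equivariance of `h : ℝ^{D × n} → ℝ^D` under a set `G` of `D × D` matrices that acts on
every vector (every `T₁` tensor) by `x ↦ A x`. -/
def IsEquivariant {D n : ℕ} (G : Set (Matrix (Fin D) (Fin D) ℝ))
    (h : (Fin n → Vec D) → Vec D) : Prop :=
  ∀ A ∈ G, ∀ X : Fin n → Vec D,
    h (fun t => Matrix.toEuclideanLin A (X t)) = Matrix.toEuclideanLin A (h X)

/-- The Minkowski inner product on `ℝ^{1+d}`, with signature `(1, d)`. -/
def minkowski {d : ℕ} (x y : Vec (d + 1)) : ℝ :=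
  x 0 * y 0 - ∑ i : Fin d, x i.succ * y i.succ

/-- The Gram matrix `diag(1, -1, …, -1)` of the Minkowski inner product. -/
def eta (d : ℕ) : Matrix (Fin (d + 1)) (Fin (d + 1)) ℝ :=
  Matrix.diagonal (Fin.cons 1 (fun _ => -1))

/-- The full Lorentz group `O(1, d)`: the matrices that preserve the Minkowski inner product. -/
def lorentzGroup (d : ℕ) : Set (Matrix (Fin (d + 1)) (Fin (d + 1)) ℝ) :=
  {A | A.transpose * eta d * A = eta d}

/-- The Minkowski inner product is nondegenerate on the span of `X₁, …, Xₙ`. -/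
def NondegenerateSpan {d n : ℕ} (X : Fin n → Vec (d + 1)) : Prop :=
  ∀ v ∈ Submodule.span ℝ (Set.range X), (∀ t, minkowski v (X t) = 0) → v = 0

/-- The invariant operator used for `O(d)`: the Euclidean norm. -/
def euclideanInv {d : ℕ} (x : Vec d) : ℝ := ‖x‖

/-- The invariant operator used for `O(1, d)`: the (signed, squared) Minkowski norm `⟨x, x⟩`. -/
def minkowskiInv {d : ℕ} (x : Vec (d + 1)) : ℝ := minkowski x x

/-! ### Multilayer perceptrons -/

/-- Multilayer perceptrons with `m` inputs and `k` outputs, of any depth and any widths. -/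
inductive MLP : ℕ → ℕ → Type
  /-- The output layer, an affine map. -/
  | output {m k : ℕ} (A : Matrix (Fin k) (Fin m) ℝ) (b : Fin k → ℝ) : MLP m k
  /-- A hidden layer of width `w`, followed by the rest of the network. -/
  | hidden {m w k : ℕ} (A : Matrix (Fin w) (Fin m) ℝ) (b : Fin w → ℝ) (rest : MLP w k) : MLP m k

/-- The function computed by a multilayer perceptron, with ReLU as activation. -/
def MLP.eval : {m k : ℕ} → MLP m k → (Fin m → ℝ) → (Fin k → ℝ)
  | _, _, .output A b, x => A.mulVec x + b
  | _, _, .hidden A b rest, x => rest.eval (fun i => max 0 ((A.mulVec x + b) i))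

/-! ### G-RepsNets with features of types `T₀` (scalars) and `T₁` (vectors) -/

/-- A feature of type `a T₀ ⊕ b T₁`. -/
abbrev Feature (D a b : ℕ) : Type := (Fin a → ℝ) × (Fin b → Vec D)

/-- A linear network on `T₁` tensors: linear combinations of the tensors with scalar weights,
no bias and no nonlinearity. -/
def combine {D b c : ℕ} (W : Matrix (Fin c) (Fin b) ℝ) (v : Fin b → Vec D) : Fin c → Vec D :=
  fun i => ∑ j, W i j • v j

/-- The input of the `T₀`-layer: the scalars, together with the vectors converted to scalars
by the invariant operator. -/
def toScalars {D a b : ℕ} (inv : Vec D → ℝ) (x : Feature D a b) : Fin (a + b) → ℝ :=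
  Fin.append x.1 (fun j => inv (x.2 j))

/-- Mixing of vectors with as many scalars, `H ↦ H * Y / inv(H)` channel by channel.
(Division by zero gives zero, so that a vector with `inv(H) = 0` is mapped to zero.) -/
def mix {D c : ℕ} (inv : Vec D → ℝ) (Y : Fin c → ℝ) (H : Fin c → Vec D) : Fin c → Vec D :=
  fun i => (Y i / inv (H i)) • H i

/-- Layers with input type `a T₀ ⊕ b T₁` and output type `a' T₀ ⊕ b' T₁`. -/
inductive Layer : ℕ → ℕ → ℕ → ℕ → Type
  /-- A `T₀`-layer and a `T₁`-layer side by side, without mixing. -/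
  | plain {a b a' b' : ℕ} (net : MLP (a + b) a') (W : Matrix (Fin b') (Fin b) ℝ) :
      Layer a b a' b'
  /-- A `T₀`-layer, and a `T₁`-layer that consists of a linear network, of mixing with the
  output of the `T₀`-layer, and of another linear network. -/
  | mixing {a b a' b' : ℕ} (net : MLP (a + b) a') (W₁ : Matrix (Fin a') (Fin b) ℝ)
      (W₂ : Matrix (Fin b') (Fin a') ℝ) : Layer a b a' b'

/-- The function computed by a layer. -/
def Layer.eval {D : ℕ} (inv : Vec D → ℝ) :
    {a b a' b' : ℕ} → Layer a b a' b' → Feature D a b → Feature D a' b'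
  | _, _, _, _, .plain net W, x => (net.eval (toScalars inv x), combine W x.2)
  | _, _, _, _, .mixing net W₁ W₂, x =>
      (net.eval (toScalars inv x),
        combine W₂ (mix inv (net.eval (toScalars inv x)) (combine W₁ x.2)))

/-- G-RepsNet models: finite compositions of layers. -/
inductive Model : ℕ → ℕ → ℕ → ℕ → Type
  | single {a b a' b' : ℕ} (L : Layer a b a' b') : Model a b a' b'
  | cons {a b a₁ b₁ a' b' : ℕ} (L : Layer a b a₁ b₁) (rest : Model a₁ b₁ a' b') : Model a b a' b'

/-- The function computed by a G-RepsNet model. -/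
def Model.eval {D : ℕ} (inv : Vec D → ℝ) :
    {a b a' b' : ℕ} → Model a b a' b' → Feature D a b → Feature D a' b'
  | _, _, _, _, .single L, x => L.eval inv x
  | _, _, _, _, .cons L rest, x => rest.eval inv (L.eval inv x)

/-- A model with `n` input tensors of type `T₁` and one output tensor of type `T₁`,
as a function `ℝ^{D × n} → ℝ^D`. -/
def Model.toFun {D n : ℕ} (inv : Vec D → ℝ) (N : Model 0 n 0 1) (X : Fin n → Vec D) : Vec D :=
  (N.eval inv (Fin.elim0, X)).2 0

end GReps

end

/-!
An equivariant map `h` takes `X` to the span of its vectors whenever the invariant form is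
nondegenerate on this span: the isometry that is `1` on the span and `-1` on its orthogonal
complement fixes `X`, so it fixes `h X` (`NondegenerateOn.apply_mem_span`). Moreover
configurations with nondegenerate spans and equal Gram matrices are related by an isometry, by
Witt's theorem (`NondegenerateOn.exists_isometry`). So the coefficients of `h X` in the vectors `X
t` can be chosen as a function of the Gram matrix, and by compactness and a partition of unity
they can be replaced by continuous functions at the price of a small error
(`exists_continuous_coeff`). Only the vanishing of `h X - ∑ t, c t • X t` is invariant, not its
Euclidean norm, and this is all that the argument uses; that the Lorentz group is not compact does
no harm.

A mixing layer multiplies a vector `H` by `Y / inv H`, where `Y` is a ReLU network in the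
invariants, so `Y` has to approximate `inv H` times the coefficient. Two points need care. Null
vectors `X s` are killed by mixing; therefore the model uses all the vectors `X s + r • X t` with
`r = 0, 1, 2, 3`, whose invariants determine the Gram matrix and of which the non-null ones span
the same space (`NondegenerateOn.exists_coeff`). And the quotient amplifies errors of `Y` near the
null vectors; therefore the coefficients are chosen to vanish there, and a soft threshold makes
the network vanish wherever its target does (`exists_reluLevel_approx_of_zero`,
`exists_model_approx`).

Approximation in measure follows by Lusin's theorem (`exists_isCompact_continuousOn`). The
exceptional configurations are null because a Gram determinant vanishes on them that is not the
zero polynomial (`ae_nondegenerateOn`). Both groups are treated at once, as the group of a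
symmetric matrix `J` (`approx_of_form`).
-/

noncomputable section

namespace GReps

open Set Topology Filter

/-! ### Uniform approximation by ReLU networks -/

/-- The scalar functions on `ℝ^m` computed by ReLU networks with `L` hidden layers. Describing them
as the span of the constants and of the rectified functions of the previous level makes closure
under linear combinations automatic. -/
def reluLevel (m : ℕ) : ℕ → Submodule ℝ ((Fin m → ℝ) → ℝ)
  | 0 => Submodule.span ℝ (insert 1 (range fun i x => x i))
  | L + 1 => Submodule.span ℝ
      (insert 1 ((fun g x => max 0 (g x)) '' (reluLevel m L : Set ((Fin m → ℝ) → ℝ))))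

theorem one_mem_reluLevel (m L : ℕ) : (1 : (Fin m → ℝ) → ℝ) ∈ reluLevel m L := by
  cases L <;> exact Submodule.subset_span (mem_insert _ _)

theorem const_mem_reluLevel (m L : ℕ) (a : ℝ) : (fun _ => a) ∈ reluLevel m L := by
  convert (reluLevel m L).smul_mem a (one_mem_reluLevel m L)
  simp

theorem relu_mem_reluLevel {m L : ℕ} {g : (Fin m → ℝ) → ℝ} (hg : g ∈ reluLevel m L) :
    (fun x => max 0 (g x)) ∈ reluLevel m (L + 1) :=
  Submodule.subset_span (mem_insert_of_mem _ ⟨g, hg, rfl⟩)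

theorem reluLevel_le_succ (m L : ℕ) : reluLevel m L ≤ reluLevel m (L + 1) := by
  intro g hg
  convert sub_mem (relu_mem_reluLevel hg) (relu_mem_reluLevel (neg_mem hg)) using 1
  ext x
  rcases le_total (g x) 0 with h | h <;> simp [h]

theorem reluLevel_mono (m : ℕ) : Monotone (reluLevel m) :=
  monotone_nat_of_le_succ (reluLevel_le_succ m)

/-- An affine map can be absorbed into the first layer of a network. -/
theorem MLP.exists_precomp_affine {m w k : ℕ} (M : MLP w k) (A : Matrix (Fin w) (Fin m) ℝ)
    (b : Fin w → ℝ) : ∃ N : MLP m k, ∀ x, N.eval x = M.eval (A.mulVec x + b) := by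
  cases M with
  | output A' b' =>
    refine ⟨.output (A' * A) (A'.mulVec b + b'), fun x => ?_⟩
    simp only [MLP.eval, Matrix.mulVec_add, Matrix.mulVec_mulVec, add_assoc]
  | hidden A' b' rest =>
    refine ⟨.hidden (A' * A) (A'.mulVec b + b') rest, fun x => ?_⟩
    simp only [MLP.eval, Matrix.mulVec_add, Matrix.mulVec_mulVec, add_assoc]

/-- Finitely many elements of a span are linear combinations of one common finite family. -/
theorem exists_common_family {V : Type*} [AddCommGroup V] [Module ℝ V] {S : Set V} {v : V} {k : ℕ}
    {f : Fin k → V} (hf : ∀ i, f i ∈ Submodule.span ℝ (insert v S)) :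
    ∃ (w : ℕ) (g : Fin w → V) (A : Matrix (Fin k) (Fin w) ℝ) (b : Fin k → ℝ),
      (∀ j, g j ∈ S) ∧ ∀ i, f i = ∑ j, A i j • g j + b i • v := by
  classical
  simp_rw [Submodule.mem_span_insert] at hf
  choose b z hz hfz using hf
  simp_rw [Finsupp.mem_span_iff_linearCombination] at hz
  choose l hl using hz
  let T : Finset S := Finset.univ.biUnion fun i => (l i).support
  refine ⟨T.card, fun j => (T.equivFin.symm j : S), fun i j => l i (T.equivFin.symm j), b,
    fun j => (T.equivFin.symm j : S).2, fun i => ?_⟩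
  rw [hfz, add_comm, ← hl i, Finsupp.linearCombination_apply,
    Finsupp.sum_of_support_subset (s := T) _ (Finset.subset_biUnion_of_mem (fun i => (l i).support)
      (Finset.mem_univ i)) _ (by simp), ← Finset.sum_coe_sort T]
  congr 1
  exact (Equiv.sum_comp T.equivFin.symm (fun t : T => l i t • ((t : S) : V))).symm

/-- The induction that turns functions of level `L` into a network builds the network from its last
layer, so it has to carry along the network `M` that comes after the functions. -/
theorem exists_MLP_comp {m : ℕ} (L : ℕ) : ∀ {w k : ℕ} (F : Fin w → (Fin m → ℝ) → ℝ),
    (∀ i, F i ∈ reluLevel m L) → ∀ M : MLP w k,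
      ∃ N : MLP m k, ∀ x, N.eval x = M.eval (fun i => F i x) := by
  induction L with
  | zero =>
    intro w k F hF M
    simp only [reluLevel, Submodule.mem_span_insert, Submodule.mem_span_range_iff_exists_fun] at hF
    choose b z hz hFz using hF
    choose A hA using hz
    obtain ⟨N, hN⟩ := M.exists_precomp_affine (Matrix.of A) b
    refine ⟨N, fun x => (hN x).trans (congrArg _ (funext fun i => ?_))⟩
    rw [hFz, ← hA]
    simp [Matrix.mulVec, dotProduct, add_comm]
  | succ L ih =>
    intro w k F hF M
    obtain ⟨p, g, A, b, hg, hFg⟩ := exists_common_family hF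
    choose G hG hGg using hg
    obtain ⟨M', hM'⟩ := M.exists_precomp_affine A b
    obtain ⟨N, hN⟩ := ih G hG (.hidden 1 0 M')
    refine ⟨N, fun x => (hN x).trans ?_⟩
    simp only [MLP.eval, hM']
    refine congrArg _ (funext fun i => ?_)
    rw [hFg]
    simp [Matrix.mulVec, dotProduct, ← hGg]

theorem exists_MLP_of_mem_reluLevel {m w : ℕ} (F : Fin w → (Fin m → ℝ) → ℝ)
    (hF : ∀ i, ∃ L, F i ∈ reluLevel m L) : ∃ N : MLP m w, ∀ x i, N.eval x i = F i x := by
  choose L hL using hF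
  obtain ⟨N, hN⟩ := exists_MLP_comp (Finset.univ.sup L) F
    (fun i => reluLevel_mono m (Finset.le_sup (Finset.mem_univ i)) (hL i))
    (.output (1 : Matrix (Fin w) (Fin w) ℝ) 0)
  exact ⟨N, fun x i => by simp [hN, MLP.eval]⟩

/-- Universal approximation, from the lattice form of the Stone–Weierstrass theorem: ReLU networks
compute maxima and minima, and affine functions interpolate any two values at two points. -/
theorem exists_reluLevel_approx {m : ℕ} {T : Set (Fin m → ℝ)} (hT : IsCompact T)
    {a : (Fin m → ℝ) → ℝ} (ha : ContinuousOn a T) {η : ℝ} (hη : 0 < η) :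
    ∃ L, ∃ φ ∈ reluLevel m L, ∀ y ∈ T, |φ y - a y| < η := by
  have : CompactSpace T := isCompact_iff_compactSpace.1 hT
  let S : Set C(T, ℝ) := {f | ∃ L, ∃ φ ∈ reluLevel m L, ∀ y : T, f y = φ y}
  have hS : closure S = ⊤ := by
    apply ContinuousMap.sublattice_closure_eq_top
    · exact ⟨0, 0, 0, zero_mem _, fun _ => rfl⟩
    · rintro f ⟨L, φ, hφ, hf⟩ g ⟨L', ψ, hψ, hg⟩
      have h1 := reluLevel_mono m (le_max_left L L') hφ
      have h2 := reluLevel_mono m (le_max_right L L') hψ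
      refine ⟨_, _, sub_mem (reluLevel_le_succ _ _ h1) (relu_mem_reluLevel (sub_mem h1 h2)),
        fun y => ?_⟩
      simp only [ContinuousMap.inf_apply, hf, hg, Pi.sub_apply]
      rcases le_total (φ y) (ψ y) with h | h <;> simp [h]
    · rintro f ⟨L, φ, hφ, hf⟩ g ⟨L', ψ, hψ, hg⟩
      have h1 := reluLevel_mono m (le_max_left L L') hφ
      have h2 := reluLevel_mono m (le_max_right L L') hψ
      refine ⟨_, _, add_mem (reluLevel_le_succ _ _ h1) (relu_mem_reluLevel (sub_mem h2 h1)),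
        fun y => ?_⟩
      simp only [ContinuousMap.sup_apply, hf, hg, Pi.sub_apply, Pi.add_apply]
      rcases le_total (φ y) (ψ y) with h | h <;> simp [h]
    · intro v x y
      by_cases hxy : x = y
      · subst hxy
        exact ⟨.const _ (v x), ⟨0, _, const_mem_reluLevel m 0 (v x), fun _ => rfl⟩, rfl, rfl⟩
      · obtain ⟨i, hi⟩ : ∃ i, (x : Fin m → ℝ) i ≠ (y : Fin m → ℝ) i := by
          by_contra! h
          exact hxy (Subtype.ext (funext h))
        have hi' : (x : Fin m → ℝ) i - (y : Fin m → ℝ) i ≠ 0 := sub_ne_zero.2 hi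
        let s := (v x - v y) / ((x : Fin m → ℝ) i - (y : Fin m → ℝ) i)
        refine ⟨⟨fun z => v y + s * ((z : Fin m → ℝ) i - (y : Fin m → ℝ) i),
            continuous_const.add (continuous_const.mul
              (((continuous_apply i).comp continuous_subtype_val).sub continuous_const))⟩,
          ⟨0, (fun _ => v y - s * (y : Fin m → ℝ) i) + s • fun z => z i,
            add_mem (const_mem_reluLevel m 0 _) (Submodule.smul_mem _ _
              (Submodule.subset_span (mem_insert_of_mem _ ⟨i, rfl⟩))), fun z => ?_⟩, ?_, ?_⟩
        · simp; ring
        · simp [s, div_mul_cancel₀ _ hi']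
        · simp
  have hmem : (⟨T.domRestrict a, ha.domRestrict⟩ : C(T, ℝ)) ∈ closure S := by rw [hS]; trivial
  obtain ⟨f, ⟨L, φ, hφ, hf⟩, hd⟩ := Metric.mem_closure_iff.1 hmem η hη
  refine ⟨L, φ, hφ, fun y hy => ?_⟩
  have := (ContinuousMap.dist_apply_le_dist ⟨y, hy⟩).trans_lt hd
  rw [hf, Real.dist_eq, abs_sub_comm] at this
  exact this

/-- Networks can vanish exactly on the zero set of the function that they approximate: the soft
threshold `r ↦ max 0 (r - η) - max 0 (-r - η)` is itself a ReLU layer, moves values by at most `η`,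
and maps `[-η, η]` to zero. -/
theorem exists_reluLevel_approx_of_zero {m : ℕ} {T : Set (Fin m → ℝ)} (hT : IsCompact T)
    {a : (Fin m → ℝ) → ℝ} (ha : ContinuousOn a T) {η : ℝ} (hη : 0 < η) :
    ∃ L, ∃ ψ ∈ reluLevel m L, ∀ y ∈ T, |ψ y - a y| < η ∧ (a y = 0 → ψ y = 0) := by
  obtain ⟨L, φ, hφ, h⟩ := exists_reluLevel_approx hT ha (half_pos hη)
  have hc := const_mem_reluLevel m L (η / 2)
  refine ⟨_, _, sub_mem (relu_mem_reluLevel (sub_mem hφ hc))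
    (relu_mem_reluLevel (sub_mem (neg_mem hφ) hc)), fun y hy => ?_⟩
  have := abs_lt.1 (h y hy)
  simp only [Pi.sub_apply, Pi.neg_apply]
  constructor
  · rw [abs_lt]
    rcases le_total 0 (φ y - η / 2) with h1 | h1 <;>
      rcases le_total 0 (-φ y - η / 2) with h2 | h2 <;>
      simp only [max_eq_left, max_eq_right, h1, h2] <;> constructor <;> linarith
  · intro h0
    rw [h0] at this
    rw [max_eq_left (by linarith), max_eq_left (by linarith), sub_self]

theorem exists_MLP_approx {m b : ℕ} {T : Set (Fin m → ℝ)} (hT : IsCompact T)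
    {a : (Fin m → ℝ) → Fin b → ℝ} (ha : ContinuousOn a T) {η : ℝ} (hη : 0 < η) :
    ∃ N : MLP m b, ∀ y ∈ T, ∀ k, |N.eval y k - a y k| < η ∧ (a y k = 0 → N.eval y k = 0) := by
  choose L ψ hψ h using fun k => exists_reluLevel_approx_of_zero hT (continuousOn_pi.1 ha k) hη
  obtain ⟨N, hN⟩ := exists_MLP_of_mem_reluLevel ψ fun k => ⟨L k, hψ k⟩
  exact ⟨N, fun y hy k => by rw [hN]; exact h k y hy⟩

/-! ### From coefficients that are constant on fibres to models -/

/-- If `h` is, on every fibre of `u`, a fixed linear combination of the vectors `H`, then near that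
fibre it is almost this combination, by compactness; a partition of unity on `u '' K` glues the
coefficients to continuous functions of `u`. They can be kept zero wherever `u · k` is small,
uniformly on `K`, since they were required to vanish where `u · k = 0`. -/
theorem exists_continuous_coeff {E : Type*} [TopologicalSpace E] [T2Space E] {D b : ℕ} {K : Set E}
    (hK : IsCompact K) {u : E → Fin b → ℝ} (hu : Continuous u) {H : E → Fin b → Vec D}
    (hH : Continuous H) {h : E → Vec D} (hh : ContinuousOn h K)
    (hloc : ∀ x₀ ∈ K, ∃ c : Fin b → ℝ, (∀ k, u x₀ k = 0 → c k = 0) ∧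
      ∀ x ∈ K, u x = u x₀ → h x = ∑ k, c k • H x k) {ε : ℝ} (hε : 0 < ε) :
    ∃ δ > 0, ∃ g : (Fin b → ℝ) → Fin b → ℝ, ContinuousOn g (u '' K) ∧
      ∀ x ∈ K, ‖∑ k, g (u x) k • H x k - h x‖ < ε ∧ ∀ k, |u x k| < δ → g (u x) k = 0 := by
  let t : ℝ → (Fin b → ℝ) → Set (Fin b → ℝ) := fun δ y =>
    {c | (∀ x ∈ K, u x = y → ‖∑ k, c k • H x k - h x‖ < ε) ∧ ∀ k, |y k| < δ → c k = 0}
  have ht : ∀ δ y, Convex ℝ (t δ y) := by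
    intro δ y c hc c' hc' p q hp hq hpq
    refine ⟨fun x hx hxy => ?_, fun k hk => by simp [hc.2 k hk, hc'.2 k hk]⟩
    have := convex_ball (h x) ε (mem_ball_iff_norm.2 (hc.1 x hx hxy))
      (mem_ball_iff_norm.2 (hc'.1 x hx hxy)) hp hq hpq
    rw [mem_ball_iff_norm] at this
    simpa [add_smul, Finset.sum_add_distrib, Finset.smul_sum, smul_smul] using this
  have hanti : ∀ {δ δ' y}, δ ≤ δ' → t δ' y ⊆ t δ y := fun hδ c hc =>
    ⟨hc.1, fun k hk => hc.2 k (hk.trans_le hδ)⟩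
  have hTc : IsCompact (u '' K) := hK.image hu
  have key : ∃ δ > 0, ∀ y ∈ u '' K, ∃ c, ∀ᶠ y' in 𝓝 y, c ∈ t δ y' := by
    refine hTc.induction_on (p := fun S => ∃ δ > 0, ∀ y ∈ S, ∃ c, ∀ᶠ y' in 𝓝 y, c ∈ t δ y')
      ⟨1, one_pos, by simp⟩ ?_ ?_ ?_
    · rintro S S' hSS' ⟨δ, hδ, hS⟩
      exact ⟨δ, hδ, fun y hy => hS y (hSS' hy)⟩
    · rintro S S' ⟨δ, hδ, hS⟩ ⟨δ', hδ', hS'⟩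
      refine ⟨min δ δ', lt_min hδ hδ', ?_⟩
      rintro y (hy | hy)
      · obtain ⟨c, hc⟩ := hS y hy
        exact ⟨c, hc.mono fun _ h => hanti (min_le_left _ _) h⟩
      · obtain ⟨c, hc⟩ := hS' y hy
        exact ⟨c, hc.mono fun _ h => hanti (min_le_right _ _) h⟩
    · rintro _ ⟨x₀, hx₀, rfl⟩
      obtain ⟨c, hc0, hc⟩ := hloc x₀ hx₀
      -- the fibres on which `c` is a bad choice form a closed set
      let B : Set E := K ∩ (fun x => ‖∑ k, c k • H x k - h x‖) ⁻¹' Ici ε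
      have hcont : ContinuousOn (fun x => ‖∑ k, c k • H x k - h x‖) K := by
        refine (ContinuousOn.sub (Continuous.continuousOn ?_) hh).norm
        exact continuous_finsetSum _ fun k _ =>
          ((continuous_apply k).comp hH).const_smul (c k)
      have hB : IsCompact B :=
        hK.of_isClosed_subset (hcont.preimage_isClosed_of_isClosed hK.isClosed isClosed_Ici)
          inter_subset_left
      have hB' : (u '' B)ᶜ ∈ 𝓝 (u x₀) := by
        refine (hB.image hu).isClosed.isOpen_compl.mem_nhds ?_
        rintro ⟨x, ⟨hxK, hx⟩, hxu⟩
        have hx : ε ≤ ‖∑ k, c k • H x k - h x‖ := hx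
        rw [← hc x hxK hxu, sub_self, norm_zero] at hx
        exact absurd hx (not_le.2 hε)
      have hδ : ∀ᶠ δ : ℝ in 𝓝[>] 0, ∀ k, c k ≠ 0 → δ < |u x₀ k| := by
        refine eventually_all.2 fun k => ?_
        by_cases hk : c k = 0
        · simp [hk]
        · have : 0 < |u x₀ k| := abs_pos.2 fun h0 => hk (hc0 k h0)
          filter_upwards [mem_nhdsWithin_of_mem_nhds (Iio_mem_nhds this)] with δ hδ _ using hδ
      obtain ⟨δ, hδ, hδ0⟩ := (hδ.and self_mem_nhdsWithin).exists
      have hev : ∀ᶠ y in 𝓝 (u x₀), c ∈ t δ y := by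
        have h2 : ∀ᶠ y in 𝓝 (u x₀), ∀ k, c k ≠ 0 → δ < |y k| := by
          refine eventually_all.2 fun k => ?_
          by_cases hk : c k = 0
          · simp [hk]
          · exact (((continuous_apply k).abs.tendsto (u x₀)).eventually
              (lt_mem_nhds (hδ k hk))).mono fun y hy _ => hy
        filter_upwards [hB', h2] with y hy h2
        refine ⟨fun x hx hxy => ?_, fun k hk => ?_⟩
        · by_contra! hcon
          exact hy ⟨x, ⟨hx, hcon⟩, hxy⟩
        · by_contra hck
          exact lt_asymm hk (h2 k hck)
      exact ⟨_, mem_nhdsWithin_of_mem_nhds (eventually_eventually_nhds.2 hev), δ, hδ0,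
        fun y hy => ⟨c, hy⟩⟩
  obtain ⟨δ, hδ, hT⟩ := key
  obtain ⟨g, hg⟩ := exists_continuous_forall_mem_convex_of_local_const
    (X := u '' K) (t := fun y => t δ y) (fun y => ht δ y) fun y => by
      obtain ⟨c, hc⟩ := hT y y.2
      exact ⟨c, (continuous_subtype_val.tendsto y).eventually hc⟩
  classical
  let g' : (Fin b → ℝ) → Fin b → ℝ := fun y => if hy : y ∈ u '' K then g ⟨y, hy⟩ else 0
  have hg' : ∀ y (hy : y ∈ u '' K), g' y = g ⟨y, hy⟩ := fun y hy => dif_pos hy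
  refine ⟨δ, hδ, g', ?_, fun x hx => ?_⟩
  · rw [continuousOn_iff_continuous_domRestrict]
    convert g.continuous using 1
    exact funext fun y => hg' y y.2
  · have hmem := mem_image_of_mem u hx
    rw [hg' _ hmem]
    exact ⟨(hg ⟨_, hmem⟩).1 x hx rfl, (hg ⟨_, hmem⟩).2⟩

/-- One mixing layer between two plain layers computes a sum of vectors `H = combine W X` weighted
by quotients `Y / inv H`, with `Y` any network in the invariants of `H`. -/
theorem exists_model_toFun_eq {D n b : ℕ} (inv : Vec D → ℝ) (W : Matrix (Fin b) (Fin n) ℝ)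
    (net : MLP (0 + b) b) : ∃ N : Model 0 n 0 1, ∀ X : Fin n → Vec D,
      N.toFun inv X = ∑ k, (net.eval (toScalars inv (Fin.elim0, combine W X)) k /
        inv (combine W X k)) • combine W X k := by
  have hid : ∀ v : Fin b → Vec D, combine (1 : Matrix (Fin b) (Fin b) ℝ) v = v := fun v => by
    ext1 i
    simp [combine, Matrix.one_apply, ite_smul]
  refine ⟨.cons (.plain (a' := 0) (.output 0 0) W) (.cons
    (.mixing net 1 (Matrix.of fun (_ : Fin 1) (_ : Fin b) => 1))
    (.single (.plain (.output 0 0) (1 : Matrix (Fin 1) (Fin 1) ℝ)))), fun X => ?_⟩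
  simp only [Model.toFun, Model.eval, Layer.eval, hid]
  simp only [combine, mix, Finset.univ_unique, Finset.sum_singleton, Matrix.of_apply, one_smul,
    Fin.default_eq_zero, Matrix.one_apply_eq]
  refine Finset.sum_congr rfl fun k _ => ?_
  congr
  exact Subsingleton.elim _ _

theorem continuous_combine {D b c : ℕ} (W : Matrix (Fin c) (Fin b) ℝ) :
    Continuous (combine W : (Fin b → Vec D) → Fin c → Vec D) :=
  continuous_pi fun i => continuous_finsetSum _ fun j _ => (continuous_apply j).const_smul (W i j)

/-- The network only has to approximate `inv H` times the continuous coefficients. Dividing by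
`inv H` is harmless: near its zeros the coefficient vanishes, and so does the network, exactly. -/
theorem exists_model_approx {D n b : ℕ} {inv : Vec D → ℝ} (hinv : Continuous inv)
    (W : Matrix (Fin b) (Fin n) ℝ) {K : Set (Fin n → Vec D)} (hK : IsCompact K)
    {h : (Fin n → Vec D) → Vec D} (hh : ContinuousOn h K)
    (hloc : ∀ X₀ ∈ K, ∃ c : Fin b → ℝ, (∀ k, inv (combine W X₀ k) = 0 → c k = 0) ∧
      ∀ X ∈ K, (∀ k, inv (combine W X k) = inv (combine W X₀ k)) →
        h X = ∑ k, c k • combine W X k) {ε : ℝ} (hε : 0 < ε) :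
    ∃ N : Model 0 n 0 1, ∀ X ∈ K, ‖N.toFun inv X - h X‖ < ε := by
  let u : (Fin n → Vec D) → Fin b → ℝ := fun X k => inv (combine W X k)
  have hu : Continuous u := continuous_pi fun k =>
    hinv.comp ((continuous_apply k).comp (continuous_combine W))
  obtain ⟨δ, hδ, g, hg, hgK⟩ := exists_continuous_coeff hK hu (continuous_combine W) hh
    (fun X₀ hX₀ => by
      obtain ⟨c, hc0, hc⟩ := hloc X₀ hX₀
      exact ⟨c, hc0, fun X hX hXu => hc X hX (congrFun hXu)⟩) (half_pos hε)
  obtain ⟨C, hC⟩ := hK.exists_bound_of_continuousOn (continuous_combine (D := D) W).continuousOn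
  let s : (Fin n → Vec D) → Fin (0 + b) → ℝ := fun X => toScalars inv (Fin.elim0, combine W X)
  have hsu : ∀ X k, s X (Fin.natAdd 0 k) = u X k := fun X k => by simp [s, toScalars, u]
  have hs : Continuous s := continuous_pi fun k => by
    refine Fin.addCases (fun i => i.elim0) (fun k => ?_) k
    simp only [hsu]
    exact (continuous_apply k).comp hu
  let r : (Fin (0 + b) → ℝ) → Fin b → ℝ := fun y k => y (Fin.natAdd 0 k)
  have hr : Continuous r := continuous_pi fun k => continuous_apply _
  have hrs : ∀ X, r (s X) = u X := fun X => funext (hsu X)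
  have hrm : MapsTo r (s '' K) (u '' K) := by
    rintro _ ⟨X, hX, rfl⟩
    exact ⟨X, hX, (hrs X).symm⟩
  have ha : ContinuousOn (fun y => r y * g (r y)) (s '' K) :=
    hr.continuousOn.mul (hg.comp hr.continuousOn hrm)
  -- `η` makes the error below, at most `b * (η / δ) * |C|`, smaller than `ε / 2`
  let η : ℝ := δ * (ε / 2 / (b * |C| + 1))
  have hden : 0 < (b : ℝ) * |C| + 1 := by positivity
  have hη : 0 < η := by positivity
  obtain ⟨net, hnet⟩ := exists_MLP_approx (hK.image hs) ha hη
  obtain ⟨N, hN⟩ := exists_model_toFun_eq (D := D) inv W net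
  refine ⟨N, fun X hX => ?_⟩
  have hcoef : ∀ k, |net.eval (s X) k / u X k - g (u X) k| ≤ η / δ := by
    intro k
    obtain ⟨h1, h2⟩ := hnet _ (mem_image_of_mem s hX) k
    simp only [hrs, Pi.mul_apply] at h1 h2
    rcases lt_or_ge |u X k| δ with hlt | hge
    · have h0 := (hgK X hX).2 k hlt
      rw [h2 (by rw [h0, mul_zero]), h0]
      simp only [zero_div, sub_zero, abs_zero]
      positivity
    · have hne : u X k ≠ 0 := abs_pos.1 (hδ.trans_le hge)
      rw [div_sub' hne, abs_div]
      exact div_le_div₀ hη.le h1.le hδ hge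
  have hsum : ‖N.toFun inv X - ∑ k, g (u X) k • combine W X k‖ < ε / 2 := by
    rw [hN, ← Finset.sum_sub_distrib]
    calc _ ≤ ∑ k : Fin b, η / δ * |C| := by
            refine norm_sum_le_of_le _ fun k _ => ?_
            rw [← sub_smul, norm_smul, Real.norm_eq_abs]
            exact mul_le_mul (hcoef k)
              (((norm_le_pi_norm _ k).trans (hC X hX)).trans (le_abs_self C)) (norm_nonneg _)
              (by positivity)
      _ = ε / 2 * ((b * |C|) / (b * |C| + 1)) := by
            simp only [Finset.sum_const, Finset.card_univ, Fintype.card_fin, nsmul_eq_mul, η,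
              mul_div_cancel_left₀ _ hδ.ne']
            ring
      _ < ε / 2 := mul_lt_of_lt_one_right (half_pos hε) ((div_lt_one hden).2 (lt_add_one _))
  calc _ ≤ ‖N.toFun inv X - ∑ k, g (u X) k • combine W X k‖ +
        ‖∑ k, g (u X) k • combine W X k - h X‖ := norm_sub_le_norm_sub_add_norm_sub _ _ _
    _ < ε := by linarith [(hgK X hX).1]

/-! ### Equivariant maps of a bilinear form -/

section BilinForm

variable {V : Type*} [AddCommGroup V] [Module ℝ V] {n : ℕ}

/-- The bilinear form `B` is nondegenerate on the span of the vectors `X`. -/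
def NondegenerateOn (B : LinearMap.BilinForm ℝ V) (X : Fin n → V) : Prop :=
  ∀ v ∈ Submodule.span ℝ (range X), (∀ t, B v (X t) = 0) → v = 0

/-- Equivariance under all linear maps that preserve `B`. -/
def IsIsometryEquivariant (B : LinearMap.BilinForm ℝ V) (h : (Fin n → V) → V) : Prop :=
  ∀ g : V →ₗ[ℝ] V, (∀ x y, B (g x) (g y) = B x y) → ∀ X, h (fun t => g (X t)) = g (h X)

/-- The reflection in the hyperplane `B`-orthogonal to `z` (the identity if `B z z = 0`). -/
def reflection (B : LinearMap.BilinForm ℝ V) (z : V) : V →ₗ[ℝ] V :=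
  LinearMap.id - ((2 / B z z) • B.flip z).smulRight z

theorem reflection_apply (B : LinearMap.BilinForm ℝ V) (z x : V) :
    reflection B z x = x - (2 / B z z * B x z) • z := by
  simp [reflection]

variable {B : LinearMap.BilinForm ℝ V}

theorem reflection_isometry (hB : ∀ x y, B x y = B y x) {z : V} (hz : B z z ≠ 0) (x y : V) :
    B (reflection B z x) (reflection B z y) = B x y := by
  simp only [reflection_apply, map_sub, map_smul, LinearMap.sub_apply, LinearMap.smul_apply,
    smul_eq_mul, hB z y]
  field_simp
  ring

theorem reflection_of_ortho {z x : V} (hx : B x z = 0) : reflection B z x = x := by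
  simp [reflection_apply, hx]

/-- The reflection in the difference of two vectors of equal norm maps one to the other. -/
theorem reflection_sub (hB : ∀ x y, B x y = B y x) {x y : V} (hxy : B x x = B y y)
    (h : B (x - y) (x - y) ≠ 0) : reflection B (x - y) x = y := by
  have h2 : B (x - y) (x - y) = 2 * B x (x - y) := by
    simp only [map_sub, LinearMap.sub_apply, hB y x, ← hxy]
    ring
  have h3 : B x (x - y) ≠ 0 := fun h0 => h (by rw [h2, h0, mul_zero])
  rw [reflection_apply, h2, show 2 / (2 * B x (x - y)) * B x (x - y) = 1 by field_simp, one_smul,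
    sub_sub_cancel]

/-- Witt's extension theorem for orthogonal families of non-null vectors. If `x` and `y` have the
same nonzero norm, then `x - y` or `x + y` is non-null, and reflections in it move `x` to `± y`. -/
theorem exists_isometry_of_orthogonal (hB : ∀ x y, B x y = B y x) {m : ℕ} (w w' : Fin m → V)
    (ho : ∀ i j, i ≠ j → B (w i) (w j) = 0) (hne : ∀ i, B (w i) (w i) ≠ 0)
    (hww' : ∀ i j, B (w i) (w j) = B (w' i) (w' j)) :
    ∃ g : V →ₗ[ℝ] V, (∀ x y, B (g x) (g y) = B x y) ∧ ∀ i, g (w i) = w' i := by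
  induction m with
  | zero => exact ⟨LinearMap.id, fun _ _ => rfl, fun i => i.elim0⟩
  | succ m ih =>
    obtain ⟨g, hg, hgw⟩ := ih (fun i => w i.castSucc) (fun i => w' i.castSucc)
      (fun i j hij => ho _ _ (by simpa using hij)) (fun i => hne _) fun i j => hww' _ _
    set x := g (w (Fin.last m)) with hx
    set y := w' (Fin.last m) with hy
    have hxy : B x x = B y y := by rw [hx, hg, hww']
    have hx0 : B x x ≠ 0 := by rw [hx, hg]; exact hne _
    have hxw : ∀ i : Fin m, B (w' i.castSucc) x = 0 := fun i => by
      rw [← hgw, hx, hg]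
      exact ho _ _ (Fin.castSucc_lt_last i).ne
    have hyw : ∀ i : Fin m, B (w' i.castSucc) y = 0 := fun i => by
      rw [hy, ← hww']
      exact ho _ _ (Fin.castSucc_lt_last i).ne
    suffices ∃ f : V →ₗ[ℝ] V, (∀ x y, B (f x) (f y) = B x y) ∧ f x = y ∧
        ∀ i : Fin m, f (w' i.castSucc) = w' i.castSucc by
      obtain ⟨f, hf, hfx, hfw⟩ := this
      refine ⟨f ∘ₗ g, fun a b => by simp [hf, hg], fun i => ?_⟩
      refine Fin.lastCases hfx (fun i => ?_) i
      simp only [LinearMap.comp_apply, hgw, hfw]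
    by_cases hs : B (x - y) (x - y) = 0
    · have hs' : B (x - -y) (x - -y) ≠ 0 := by
        intro h
        simp only [map_sub, map_neg, LinearMap.sub_apply, LinearMap.neg_apply] at hs h
        exact hx0 (by linarith)
      have hy0 : B y y ≠ 0 := hxy ▸ hx0
      refine ⟨reflection B y ∘ₗ reflection B (x - -y), fun a b => ?_, ?_, fun i => ?_⟩
      · simp only [LinearMap.comp_apply, reflection_isometry hB hy0, reflection_isometry hB hs']
      · rw [LinearMap.comp_apply, reflection_sub hB (by simpa using hxy) hs', reflection_apply,
          map_neg, LinearMap.neg_apply, mul_neg, div_mul_cancel₀ _ hy0, neg_smul, two_smul]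
        abel
      · rw [LinearMap.comp_apply, reflection_of_ortho (z := x - -y) (by simp [hxw, hyw]),
          reflection_of_ortho (hyw i)]
    · exact ⟨reflection B (x - y), reflection_isometry hB hs, reflection_sub hB hxy hs,
        fun i => reflection_of_ortho (by simp [hxw, hyw])⟩

theorem NondegenerateOn.exists_orthogonal (hB : ∀ x y, B x y = B y x) {X : Fin n → V}
    (hX : NondegenerateOn B X) : ∃ (m : ℕ) (w : Fin m → V),
      (∀ i, w i ∈ Submodule.span ℝ (range X)) ∧ (∀ t, X t ∈ Submodule.span ℝ (range w)) ∧
      (∀ i j, i ≠ j → B (w i) (w j) = 0) ∧ ∀ i, B (w i) (w i) ≠ 0 := by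
  let S := Submodule.span ℝ (range X)
  have : FiniteDimensional ℝ S := FiniteDimensional.span_of_finite ℝ (finite_range X)
  have : Invertible (2 : ℝ) := invertibleOfNonzero two_ne_zero
  obtain ⟨v, hv⟩ := LinearMap.BilinForm.exists_orthogonal_basis (B := B.restrict S)
    ⟨fun x y => hB x y⟩
  have ho : ∀ i j, i ≠ j → B (v i) (v j) = 0 := fun i j hij => hv hij
  have hspan : Submodule.span ℝ (range fun i => (v i : V)) = S := by
    have := congrArg (Submodule.map S.subtype) v.span_eq
    rw [Submodule.map_span, ← range_comp, Submodule.map_top, Submodule.range_subtype] at this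
    exact this
  have hXS : ∀ t, X t ∈ Submodule.span ℝ (range fun i => (v i : V)) := fun t => by
    rw [hspan]
    exact Submodule.subset_span (mem_range_self t)
  refine ⟨_, fun i => v i, fun i => (v i).2, hXS, ho, fun i hi => ?_⟩
  -- a null vector of an orthogonal basis is orthogonal to everything
  have h0 : ∀ x ∈ Submodule.span ℝ (range fun i => (v i : V)), B (v i) x = 0 := by
    intro x hx
    induction hx using Submodule.span_induction with
    | mem x hx =>
      obtain ⟨j, rfl⟩ := hx
      by_cases hij : i = j
      · exact hij ▸ hi
      · exact ho i j hij
    | zero => exact map_zero _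
    | add x y _ _ hx hy => rw [map_add, hx, hy, add_zero]
    | smul a x _ hx => rw [map_smul, hx, smul_zero]
  exact v.ne_zero i (Subtype.ext (hX _ (v i).2 fun t => h0 _ (hXS t)))

/-- Values of equivariant maps lie in the span of the arguments: the isometry that is `1` on the
span and `-1` on its orthogonal complement fixes the arguments, hence the value. -/
theorem NondegenerateOn.apply_mem_span (hB : ∀ x y, B x y = B y x) {X : Fin n → V}
    (hX : NondegenerateOn B X) {h : (Fin n → V) → V} (hh : IsIsometryEquivariant B h) :
    h X ∈ Submodule.span ℝ (range X) := by
  obtain ⟨m, w, hwX, hXw, ho, hne⟩ := hX.exists_orthogonal hB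
  -- the orthogonal projection to the span
  let P : V →ₗ[ℝ] V := ∑ i, ((B (w i) (w i))⁻¹ • B.flip (w i)).smulRight (w i)
  have hP : ∀ x, P x = ∑ i, ((B (w i) (w i))⁻¹ * B x (w i)) • w i := fun x => by
    simp [P, LinearMap.sum_apply]
  have hPw : ∀ x j, B (P x) (w j) = B x (w j) := by
    intro x j
    rw [hP, map_sum, LinearMap.sum_apply, Finset.sum_eq_single j]
    · simp only [map_smul, LinearMap.smul_apply, smul_eq_mul]
      field_simp [hne j]
    · intro i _ hij
      rw [map_smul, LinearMap.smul_apply, ho i j hij, smul_zero]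
    · simp
  have hPP : ∀ x y, B (P x) (P y) = B (P x) y := by
    intro x y
    conv_lhs => rw [hB, hP x]
    conv_rhs => rw [hB, hP x]
    simp only [map_sum, map_smul, hPw]
  have hfix : ∀ x ∈ Submodule.span ℝ (range w), P x = x := by
    intro x hx
    induction hx using Submodule.span_induction with
    | mem x hx =>
      obtain ⟨j, rfl⟩ := hx
      rw [hP, Finset.sum_eq_single j]
      · rw [inv_mul_cancel₀ (hne j), one_smul]
      · intro i _ hij
        rw [ho j i hij.symm, mul_zero, zero_smul]
      · simp
    | zero => exact map_zero _
    | add x y _ _ hx hy => rw [map_add, hx, hy]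
    | smul a x _ hx => rw [map_smul, hx]
  have hR := hh ((2 : ℝ) • P - LinearMap.id) (fun x y => by
    have h1 := hPP x y
    have h2 : B x (P y) = B (P x) (P y) := by rw [hB, ← hPP, hB]
    simp only [LinearMap.sub_apply, LinearMap.smul_apply, LinearMap.id_apply, map_sub, map_smul,
      smul_eq_mul]
    linarith) X
  have hRX : (fun t => ((2 : ℝ) • P - LinearMap.id : V →ₗ[ℝ] V) (X t)) = X := funext fun t => by
    simp [hfix _ (hXw t), two_smul]
  rw [hRX, LinearMap.sub_apply, LinearMap.smul_apply, LinearMap.id_apply, two_smul] at hR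
  have hPh : P (h X) = h X := by
    have h2 : (2 : ℝ) • P (h X) = (2 : ℝ) • h X := by
      rw [two_smul, two_smul, ← sub_eq_iff_eq_add]
      exact hR.symm
    exact smul_right_injective V (two_ne_zero' ℝ) h2
  rw [← hPh, hP]
  exact Submodule.sum_mem _ fun i _ => Submodule.smul_mem _ _ (hwX i)

theorem NondegenerateOn.exists_isometry (hB : ∀ x y, B x y = B y x) {X Y : Fin n → V}
    (hX : NondegenerateOn B X) (hY : NondegenerateOn B Y)
    (hXY : ∀ s t, B (X s) (X t) = B (Y s) (Y t)) :
    ∃ g : V →ₗ[ℝ] V, (∀ x y, B (g x) (g y) = B x y) ∧ ∀ t, g (X t) = Y t := by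
  obtain ⟨m, w, hwX, hXw, ho, hne⟩ := hX.exists_orthogonal hB
  let F : (Fin n → V) → (Fin n → ℝ) →ₗ[ℝ] V := fun Z => Fintype.linearCombination ℝ Z
  have hFB : ∀ a b, B (F X a) (F X b) = B (F Y a) (F Y b) := fun a b => by
    simp only [F, Fintype.linearCombination_apply, map_sum, LinearMap.sum_apply, map_smul,
      LinearMap.smul_apply, hXY]
  -- linear relations between the `X t` also hold between the `Y t`
  have hF0 : ∀ a, F X a = 0 → F Y a = 0 := by
    intro a ha
    refine hY _ ?_ fun t => ?_
    · rw [← Fintype.range_linearCombination]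
      exact ⟨a, rfl⟩
    · have := hFB a (Pi.single t 1)
      rw [ha, map_zero, LinearMap.zero_apply] at this
      simpa [F] using this.symm
  have hwF : ∀ i, ∃ a, F X a = w i := fun i => by
    have := hwX i
    rwa [← Fintype.range_linearCombination] at this
  choose a ha using hwF
  obtain ⟨g, hg, hgw⟩ := exists_isometry_of_orthogonal hB w (fun i => F Y (a i)) ho hne
    fun i j => by rw [← ha, ← ha, hFB]
  refine ⟨g, hg, fun t => ?_⟩
  have hXt := hXw t
  rw [← Fintype.range_linearCombination] at hXt
  obtain ⟨c, hc⟩ := hXt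
  rw [Fintype.linearCombination_apply] at hc
  have h0 := hF0 (∑ i, c i • a i - Pi.single t 1) (by
    rw [map_sub, map_sum]
    simp only [map_smul, ha, hc]
    simp [F])
  rw [map_sub, map_sum, sub_eq_zero] at h0
  simp only [map_smul] at h0
  rw [← hc, map_sum]
  simp only [map_smul, hgw, h0]
  simp [F]

/-- The non-null ones among the vectors `X s + r • X t` with `r = 0, 1, 2, 3` span all the `X s`:
if `X s` is null and nonzero, then it is not orthogonal to some `X t`, and `X s + r • X t` is null
for at most one nonzero `r`, so that two of these vectors are left to solve for `X s`. -/
theorem NondegenerateOn.mem_span_nonnull (hB : ∀ x y, B x y = B y x) {X : Fin n → V}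
    (hX : NondegenerateOn B X) (s : Fin n) : X s ∈ Submodule.span ℝ
      ((fun p : Fin n × Fin n × Fin 4 => X p.1 + (p.2.2 : ℝ) • X p.2.1) ''
        {p | B (X p.1 + (p.2.2 : ℝ) • X p.2.1) (X p.1 + (p.2.2 : ℝ) • X p.2.1) ≠ 0}) := by
  by_cases hs : B (X s) (X s) = 0
  · by_cases hall : ∀ t, B (X s) (X t) = 0
    · rw [hX (X s) (Submodule.subset_span (mem_range_self s)) hall]
      exact zero_mem _
    · push Not at hall
      obtain ⟨t, ht⟩ := hall
      have hq : ∀ r : ℝ, B (X s + r • X t) (X s + r • X t) =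
          r * (2 * B (X s) (X t) + r * B (X t) (X t)) := fun r => by
        simp only [map_add, map_smul, LinearMap.add_apply, LinearMap.smul_apply, smul_eq_mul, hs,
          hB (X t) (X s)]
        ring
      obtain ⟨r, r', hr, hr', hrr'⟩ : ∃ r r' : Fin 4,
          B (X s + (r : ℝ) • X t) (X s + (r : ℝ) • X t) ≠ 0 ∧
          B (X s + (r' : ℝ) • X t) (X s + (r' : ℝ) • X t) ≠ 0 ∧ (r : ℝ) ≠ r' := by
        simp only [hq]
        by_cases h1 : (1 : ℝ) * (2 * B (X s) (X t) + 1 * B (X t) (X t)) = 0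
        · refine ⟨2, 3, ?_, ?_, ?_⟩
          · norm_num
            intro h
            exact ht (by linarith)
          · norm_num
            intro h
            exact ht (by linarith)
          · norm_num
        · by_cases h2 : (2 : ℝ) * (2 * B (X s) (X t) + 2 * B (X t) (X t)) = 0
          · refine ⟨1, 3, ?_, ?_, ?_⟩
            · simpa using h1
            · norm_num
              intro h
              exact ht (by linarith)
            · norm_num
          · refine ⟨1, 2, ?_, ?_, ?_⟩
            · simpa using h1
            · simpa using h2
            · norm_num
      have hd : (r' : ℝ) - r ≠ 0 := sub_ne_zero.2 hrr'.symm
      have hXs : X s = ((r' : ℝ) - r)⁻¹ • ((r' : ℝ) • (X s + (r : ℝ) • X t) -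
          (r : ℝ) • (X s + (r' : ℝ) • X t)) := by
        rw [eq_inv_smul_iff₀ hd]
        module
      rw [hXs]
      exact Submodule.smul_mem _ _ (sub_mem
        (Submodule.smul_mem _ _ (Submodule.subset_span ⟨(s, t, r), hr, rfl⟩))
        (Submodule.smul_mem _ _ (Submodule.subset_span ⟨(s, t, r'), hr', rfl⟩)))
  · exact Submodule.subset_span ⟨(s, s, 0), by simpa using hs, by simp⟩

end BilinForm

/-- The weights that form all `X s + r • X t` with `r = 0, 1, 2, 3` from `X`. -/
def pairWeights (n : ℕ) : Matrix (Fin (Fintype.card (Fin n × Fin n × Fin 4))) (Fin n) ℝ :=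
  Matrix.of fun k =>
    let p := (Fintype.equivFin (Fin n × Fin n × Fin 4)).symm k
    Pi.single p.1 1 + (p.2.2 : ℝ) • Pi.single p.2.1 1

theorem combine_pairWeights {D n : ℕ} (X : Fin n → Vec D) (p : Fin n × Fin n × Fin 4) :
    combine (pairWeights n) X (Fintype.equivFin _ p) = X p.1 + (p.2.2 : ℝ) • X p.2.1 := by
  simp only [combine, pairWeights, Matrix.of_apply, Equiv.symm_apply_apply, Pi.add_apply,
    Pi.smul_apply, add_smul, Finset.sum_add_distrib, smul_assoc, ← Finset.smul_sum]
  simp [Pi.single_apply, ite_smul]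

theorem sum_smul_combine {D b n : ℕ} (c : Fin b → ℝ) (W : Matrix (Fin b) (Fin n) ℝ)
    (X : Fin n → Vec D) : ∑ k, c k • combine W X k = ∑ j, (∑ k, c k * W k j) • X j := by
  simp only [combine, Finset.smul_sum, Finset.sum_smul, smul_smul]
  exact Finset.sum_comm

/-- The invariants of the vectors `X s + r • X t` determine the Gram matrix of `X`, hence `X` up to
an isometry; so they determine the coefficients of `h X`, which only need the non-null vectors. -/
theorem NondegenerateOn.exists_coeff {D n : ℕ} {B : LinearMap.BilinForm ℝ (Vec D)}
    (hB : ∀ x y, B x y = B y x) {inv : Vec D → ℝ} {φ : ℝ → ℝ} (hφ : ∀ x, B x x = φ (inv x))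
    (hφ0 : φ 0 = 0) {h : (Fin n → Vec D) → Vec D} (hh : IsIsometryEquivariant B h)
    {X : Fin n → Vec D} (hX : NondegenerateOn B X) :
    ∃ c : Fin _ → ℝ, (∀ k, inv (combine (pairWeights n) X k) = 0 → c k = 0) ∧
      ∀ Y, NondegenerateOn B Y →
        (∀ k, inv (combine (pairWeights n) Y k) = inv (combine (pairWeights n) X k)) →
        h Y = ∑ k, c k • combine (pairWeights n) Y k := by
  let e := Fintype.equivFin (Fin n × Fin n × Fin 4)
  have hmem := Submodule.span_le.2 (range_subset_iff.2 (hX.mem_span_nonnull hB))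
    (hX.apply_mem_span hB hh)
  obtain ⟨l, hl, hlX⟩ := (Finsupp.mem_span_image_iff_linearCombination ℝ).1 hmem
  have hsum : h X = ∑ k, l (e.symm k) • combine (pairWeights n) X k := by
    rw [← hlX, Finsupp.linearCombination_apply, Finsupp.sum_fintype _ _ (by simp),
      ← Equiv.sum_comp e]
    simp only [e, combine_pairWeights, Equiv.symm_apply_apply]
  refine ⟨fun k => l (e.symm k), fun k hk => ?_, fun Y hY hXY => ?_⟩
  · by_contra hne
    have hmem : e.symm k ∈ {p : Fin n × Fin n × Fin 4 |
        B (X p.1 + (p.2.2 : ℝ) • X p.2.1) (X p.1 + (p.2.2 : ℝ) • X p.2.1) ≠ 0} :=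
      hl (Finsupp.mem_support_iff.2 hne)
    refine hmem ?_
    rw [hφ, ← combine_pairWeights X (e.symm k)]
    simp only [e, Equiv.apply_symm_apply, hk, hφ0]
  · have hq : ∀ s t (r : Fin 4), B (X s + (r : ℝ) • X t) (X s + (r : ℝ) • X t) =
        B (Y s + (r : ℝ) • Y t) (Y s + (r : ℝ) • Y t) := fun s t r => by
      rw [hφ, hφ, ← combine_pairWeights X (s, t, r), ← combine_pairWeights Y (s, t, r), hXY]
    have hG : ∀ s t, B (X s) (X t) = B (Y s) (Y t) := fun s t => by
      have h0 := hq s s 0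
      have h1 := hq t t 0
      have h2 := hq s t 1
      simp [hB (X t) (X s), hB (Y t) (Y s)] at h0 h1 h2
      linarith
    obtain ⟨g, hg, hgX⟩ := hX.exists_isometry hB hY hG
    rw [← funext hgX, hh g hg, hsum, sum_smul_combine, sum_smul_combine, map_sum]
    simp only [map_smul]

/-! ### Matrix groups of bilinear forms -/

/-- The bilinear form `x ↦ y ↦ xᵀ J y` on column vectors. -/
def form {D : ℕ} (J : Matrix (Fin D) (Fin D) ℝ) : LinearMap.BilinForm ℝ (Vec D) :=
  (Matrix.toBilin' J).comp (WithLp.linearEquiv 2 ℝ (Fin D → ℝ)).toLinearMap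
    (WithLp.linearEquiv 2 ℝ (Fin D → ℝ)).toLinearMap

theorem form_apply {D : ℕ} (J : Matrix (Fin D) (Fin D) ℝ) (x y : Vec D) :
    form J x y = ∑ i, ∑ j, x i * J i j * y j := by
  simp [form, Matrix.toBilin'_apply]

theorem form_one {d : ℕ} (x y : Vec d) : form 1 x y = ∑ i, x i * y i := by
  simp [form_apply, Matrix.one_apply]

theorem form_eta {d : ℕ} (x y : Vec (d + 1)) : form (eta d) x y = minkowski x y := by
  simp [form_apply, eta, minkowski, Matrix.diagonal_apply, Fin.sum_univ_succ,
    sub_eq_add_neg]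

theorem form_comm {D : ℕ} {J : Matrix (Fin D) (Fin D) ℝ} (hJ : J.IsSymm) (x y : Vec D) :
    form J x y = form J y x := by
  rw [form_apply, form_apply, Finset.sum_comm]
  refine Finset.sum_congr rfl fun i _ => Finset.sum_congr rfl fun j _ => ?_
  rw [hJ.apply]
  ring

theorem isIsometryEquivariant_form {D n : ℕ} {J : Matrix (Fin D) (Fin D) ℝ}
    {h : (Fin n → Vec D) → Vec D} (hh : IsEquivariant {A | A.transpose * J * A = J} h) :
    IsIsometryEquivariant (form J) h := by
  intro g hg X
  obtain ⟨A, rfl⟩ := Matrix.toEuclideanLin.surjective g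
  refine hh A ?_ X
  refine Matrix.toBilin'.injective ?_
  rw [← Matrix.toBilin'_comp]
  refine LinearMap.ext fun x => LinearMap.ext fun y => ?_
  exact hg (WithLp.toLp 2 x) (WithLp.toLp 2 y)

/-! ### Measurable functions are continuous on large compact sets -/

open MeasureTheory in
/-- Lusin's theorem, with the compact set inside a given set of full measure. -/
theorem exists_isCompact_continuousOn {E F : Type*} [TopologicalSpace E] [T2Space E]
    [MeasurableSpace E] [OpensMeasurableSpace E] {μ : Measure E} [IsFiniteMeasure μ]
    [μ.InnerRegularCompactLTTop] [TopologicalSpace F] [SecondCountableTopology F]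
    [MeasurableSpace F] [OpensMeasurableSpace F] {h : E → F} (hh : Measurable h) {p : E → Prop}
    (hp : ∀ᵐ x ∂μ, p x) {ε : ENNReal} (hε : ε ≠ 0) :
    ∃ K, IsCompact K ∧ (∀ x ∈ K, p x) ∧ ContinuousOn h K ∧ μ Kᶜ < ε := by
  obtain ⟨R, hR, hRm, hR0⟩ := exists_measurable_superset_of_null (ae_iff.1 hp)
  let ι := TopologicalSpace.countableBasis F
  have : Countable ι := (TopologicalSpace.countable_countableBasis F).to_subtype
  let A : Option (ι × Bool) → Set E
    | none => Rᶜ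
    | some (U, true) => h ⁻¹' U
    | some (U, false) => h ⁻¹' (U : Set F)ᶜ
  have hU : ∀ U : ι, MeasurableSet (U : Set F) := fun U =>
    (TopologicalSpace.isOpen_of_mem_countableBasis U.2).measurableSet
  have hA : ∀ j, MeasurableSet (A j) := by
    rintro (_ | ⟨U, _ | _⟩)
    · exact hRm.compl
    · exact hh (hU U).compl
    · exact hh (hU U)
  obtain ⟨δ, hδ, hδε⟩ := ENNReal.exists_pos_sum_of_countable' hε (Option (ι × Bool))
  choose C hCA hC hCδ using fun j =>
    (hA j).exists_isCompact_sdiff_lt (measure_ne_top μ _) (hδ j).ne'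
  refine ⟨C none ∩ ⋂ U : ι, (C (some (U, true)) ∪ C (some (U, false))), ?_, ?_, ?_, ?_⟩
  · exact (hC none).inter_right
      (isClosed_iInter fun U => (hC _).isClosed.union (hC _).isClosed)
  · exact fun x hx => by_contra fun hpx => hCA none hx.1 (hR hpx)
  · rw [continuousOn_iff_continuous_domRestrict,
      (TopologicalSpace.isBasis_countableBasis F).continuous_iff]
    intro U hUb
    refine isOpen_induced_iff.2 ⟨(C (some (⟨U, hUb⟩, false)))ᶜ, (hC _).isClosed.isOpen_compl, ?_⟩
    ext ⟨x, hx⟩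
    rcases mem_iInter.1 hx.2 ⟨U, hUb⟩ with h1 | h1
    · have hxU : h x ∈ U := hCA _ h1
      exact iff_of_true (fun h2 => hCA _ h2 hxU) hxU
    · exact iff_of_false (fun h2 => h2 h1) (hCA _ h1)
  · have hsub : (C none ∩ ⋂ U : ι, (C (some (U, true)) ∪ C (some (U, false))))ᶜ ⊆
        R ∪ ⋃ j, A j \ C j := by
      intro x hx
      by_contra hcon
      simp only [mem_union, mem_iUnion, Set.mem_sdiff, not_or, not_exists, not_and, not_not] at hcon
      refine hx ⟨hcon.2 none hcon.1, mem_iInter.2 fun U => ?_⟩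
      by_cases hxU : h x ∈ (U : Set F)
      · exact Or.inl (hcon.2 (some (U, true)) hxU)
      · exact Or.inr (hcon.2 (some (U, false)) hxU)
    calc _ ≤ μ R + μ (⋃ j, A j \ C j) := (measure_mono hsub).trans (measure_union_le _ _)
      _ ≤ 0 + ∑' j, δ j := by
        rw [hR0]
        exact add_le_add_right ((measure_iUnion_le _).trans
          (ENNReal.tsum_le_tsum fun j => (hCδ j).le)) _
      _ < ε := by rwa [zero_add]

/-! ### Approximation for the group of a symmetric form -/

/-- Both modes of approximation, for the group of an arbitrary symmetric bilinear form `J` and any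
invariant of which `xᵀ J x` is a function. -/
theorem approx_of_form {D n : ℕ} {J : Matrix (Fin D) (Fin D) ℝ} (hJ : J.IsSymm) {inv : Vec D → ℝ}
    (hinv : Continuous inv) {φ : ℝ → ℝ} (hφ : ∀ x, form J x x = φ (inv x)) (hφ0 : φ 0 = 0)
    {h : (Fin n → Vec D) → Vec D} (hh : IsEquivariant {A | A.transpose * J * A = J} h) :
    (∀ K : Set (Fin n → Vec D), IsCompact K → (∀ X ∈ K, NondegenerateOn (form J) X) →
      ContinuousOn h K → ∀ ε : ℝ, 0 < ε →
        ∃ N : Model 0 n 0 1, ∀ X ∈ K, ‖N.toFun inv X - h X‖ < ε) ∧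
    (Measurable h → ∀ μ : MeasureTheory.Measure (Fin n → Vec D),
      MeasureTheory.IsFiniteMeasure μ → (∀ᵐ X ∂μ, NondegenerateOn (form J) X) →
        ∀ ε : ℝ, 0 < ε → ∃ N : Model 0 n 0 1,
          μ {X | ε ≤ ‖N.toFun inv X - h X‖} < ENNReal.ofReal ε) := by
  have hcompact : ∀ K : Set (Fin n → Vec D), IsCompact K →
      (∀ X ∈ K, NondegenerateOn (form J) X) → ContinuousOn h K → ∀ ε : ℝ, 0 < ε →
        ∃ N : Model 0 n 0 1, ∀ X ∈ K, ‖N.toFun inv X - h X‖ < ε := by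
    intro K hK hKX hhK ε hε
    refine exists_model_approx hinv (pairWeights n) hK hhK (fun X hX => ?_) hε
    obtain ⟨c, hc0, hc⟩ := (hKX X hX).exists_coeff (form_comm hJ) hφ hφ0
      (isIsometryEquivariant_form hh)
    exact ⟨c, hc0, fun Y hY => hc Y (hKX Y hY)⟩
  refine ⟨hcompact, fun hm μ hμ hμX ε hε => ?_⟩
  obtain ⟨K, hK, hKX, hhK, hμK⟩ :=
    exists_isCompact_continuousOn hm hμX (ENNReal.ofReal_pos.2 hε).ne'
  obtain ⟨N, hN⟩ := hcompact K hK hKX hhK ε hε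
  exact ⟨N, (MeasureTheory.measure_mono fun X hX hXK => not_lt.2 hX (hN X hXK)).trans_lt hμK⟩

/-! ### Almost every configuration spans a nondegenerate subspace -/

open MeasureTheory in
/-- If on every line through `a` the function `f` has only countably many zeros, then its zero set
is null: by Fubini, almost all of its rescalings with centre `a` are null. -/
theorem ae_ne_zero_of_countable_on_lines {E : Type*} [NormedAddCommGroup E] [NormedSpace ℝ E]
    [FiniteDimensional ℝ E] [MeasurableSpace E] [BorelSpace E] (μ : Measure E)
    [μ.IsAddHaarMeasure] {f : E → ℝ} (hf : Continuous f) (a : E)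
    (hline : ∀ v, {t : ℝ | f (a + t • v) = 0}.Countable) : ∀ᵐ x ∂μ, f x ≠ 0 := by
  have hmeas : MeasurableSet {x : E × ℝ | f (a + x.2 • x.1) ≠ 0} :=
    (isOpen_ne_fun (by fun_prop) continuous_const).measurableSet
  have h1 : ∀ᵐ v ∂μ, ∀ᵐ t : ℝ, f (a + t • v) ≠ 0 := Eventually.of_forall fun v => by
    simpa [ae_iff] using (hline v).measure_zero volume
  rw [Measure.ae_ae_comm (p := fun v t => f (a + t • v) ≠ 0) hmeas] at h1
  have h2 : ∀ᵐ t : ℝ, t ≠ 0 := by simp [ae_iff]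
  obtain ⟨t, ht, ht0⟩ := (h1.and h2).exists
  rw [ae_iff] at ht ⊢
  have hset : {x | ¬f x ≠ 0} = (fun x => x + -a) ⁻¹' ((fun x => t⁻¹ • x) ⁻¹'
      {v | ¬f (a + t • v) ≠ 0}) := by
    ext x
    simp [smul_inv_smul₀ ht0]
  rw [hset, measure_preimage_add_right, Measure.addHaar_preimage_smul μ (inv_ne_zero ht0), ht,
    mul_zero]

/-- The Gram matrix of the first `r` vectors. -/
def leadingGram {D n r : ℕ} (B : LinearMap.BilinForm ℝ (Vec D)) (hr : r ≤ n)
    (X : Fin n → Vec D) : Matrix (Fin r) (Fin r) ℝ :=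
  Matrix.of fun i j => B (X (Fin.castLE hr i)) (X (Fin.castLE hr j))

theorem continuous_form {D : ℕ} (J : Matrix (Fin D) (Fin D) ℝ) :
    Continuous fun p : Vec D × Vec D => form J p.1 p.2 := by
  simp only [form_apply]
  fun_prop

/-- Along a line, the Gram determinant is a polynomial in the parameter. -/
theorem countable_leadingGram_det_eq_zero {D n r : ℕ} (B : LinearMap.BilinForm ℝ (Vec D))
    (hr : r ≤ n) {a : Fin n → Vec D} (ha : (leadingGram B hr a).det ≠ 0) (v : Fin n → Vec D) :
    {t : ℝ | (leadingGram B hr (a + t • v)).det = 0}.Countable := by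
  let M : Matrix (Fin r) (Fin r) (Polynomial ℝ) := Matrix.of fun i j =>
    let i := Fin.castLE hr i
    let j := Fin.castLE hr j
    Polynomial.C (B (a i) (a j)) + Polynomial.X * Polynomial.C (B (a i) (v j) + B (v i) (a j)) +
      Polynomial.X ^ 2 * Polynomial.C (B (v i) (v j))
  have hM : ∀ t : ℝ, M.det.eval t = (leadingGram B hr (a + t • v)).det := by
    intro t
    rw [← Polynomial.coe_evalRingHom, RingHom.map_det]
    congr 1
    ext i j
    simp [M, leadingGram]
    ring
  have h0 : M.det ≠ 0 := fun h => ha (by simpa [h] using (hM 0).symm)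
  refine (M.det.roots.toFinset.finite_toSet.subset fun t ht => ?_).countable
  have ht : (leadingGram B hr (a + t • v)).det = 0 := ht
  simpa [h0, hM] using ht

/-- A nondegenerate leading Gram matrix settles the matter if its vectors are all of `X`, or if
there are as many of them as dimensions, so that they span the whole space. -/
theorem nondegenerateOn_of_leadingGram {D n r : ℕ} {B : LinearMap.BilinForm ℝ (Vec D)}
    (hr : r ≤ n) (hrD : r = n ∨ r = D) {X : Fin n → Vec D}
    (hX : (leadingGram B hr X).det ≠ 0) : NondegenerateOn B X := by
  let Z : Fin r → Vec D := fun i => X (Fin.castLE hr i)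
  have hZ : ∀ c : Fin r → ℝ, (∀ j, B (∑ i, c i • Z i) (Z j) = 0) → c = 0 := by
    intro c hc
    refine Matrix.eq_zero_of_vecMul_eq_zero hX (funext fun j => ?_)
    have := hc j
    simpa [Matrix.vecMul, dotProduct, leadingGram, Z, map_sum, LinearMap.sum_apply] using this
  have hind : LinearIndependent ℝ Z := Fintype.linearIndependent_iff.2 fun c hc =>
    congrFun (hZ c fun j => by rw [hc, map_zero, LinearMap.zero_apply])
  have hspan : Submodule.span ℝ (range X) ≤ Submodule.span ℝ (range Z) := by
    rcases hrD with rfl | rfl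
    · exact le_rfl
    · rw [hind.span_eq_top_of_card_eq_finrank' (by simp)]
      exact le_top
  intro v hv hvX
  have hv := hspan hv
  rw [← Fintype.range_linearCombination] at hv
  obtain ⟨c, rfl⟩ := hv
  rw [Fintype.linearCombination_apply] at hvX ⊢
  simp [hZ c fun j => hvX _]

theorem ae_nondegenerateOn (d n : ℕ) :
    ∀ᵐ X : Fin n → Vec (d + 1), NondegenerateOn (form (eta d)) X := by
  have hr : min n (d + 1) ≤ n := min_le_left _ _
  -- the standard basis vectors, padded with zeros
  let a : Fin n → Vec (d + 1) := fun i =>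
    if h : (i : ℕ) < d + 1 then EuclideanSpace.single ⟨i, h⟩ 1 else 0
  have ha : leadingGram (form (eta d)) hr a = Matrix.diagonal
      ((Fin.cons 1 fun _ => -1 : Fin (d + 1) → ℝ) ∘ Fin.castLE (min_le_right n (d + 1))) := by
    rw [← Matrix.submatrix_diagonal _ _ (Fin.castLE_injective _)]
    ext i j
    have hi : (i : ℕ) < d + 1 := i.2.trans_le (min_le_right _ _)
    have hj : (j : ℕ) < d + 1 := j.2.trans_le (min_le_right _ _)
    simp only [leadingGram, Matrix.of_apply, a, Fin.val_castLE, hi, hj, dif_pos, form_apply]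
    simp [eta, Fin.castLE]
  have hdet : (leadingGram (form (eta d)) hr a).det ≠ 0 := by
    rw [ha, Matrix.det_diagonal, Finset.prod_ne_zero_iff]
    intro i _
    rw [Function.comp_apply]
    generalize Fin.castLE (min_le_right n (d + 1)) i = j
    cases j using Fin.cases <;> simp
  have hcont : Continuous fun X : Fin n → Vec (d + 1) =>
      (leadingGram (form (eta d)) hr X).det := by
    refine Continuous.matrix_det (continuous_matrix fun i j => ?_)
    have hij : Continuous fun X : Fin n → Vec (d + 1) =>
        (X (Fin.castLE hr i), X (Fin.castLE hr j)) := by fun_prop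
    exact (continuous_form (eta d)).comp hij
  filter_upwards [ae_ne_zero_of_countable_on_lines MeasureTheory.volume hcont a
    (countable_leadingGram_det_eq_zero _ hr hdet)] with X hX
  exact nondegenerateOn_of_leadingGram hr (min_choice _ _) hX

/-! ### The Euclidean and the Minkowski form -/

theorem nondegenerateSpan_iff {d n : ℕ} {X : Fin n → Vec (d + 1)} :
    NondegenerateSpan X ↔ NondegenerateOn (form (eta d)) X := by
  simp only [NondegenerateSpan, NondegenerateOn, form_eta]

theorem nondegenerateOn_form_one {d n : ℕ} (X : Fin n → Vec d) :
    NondegenerateOn (form 1) X := by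
  intro v hv hvX
  have h0 : form 1 v v = 0 := by
    have : Submodule.span ℝ (range X) ≤ LinearMap.ker (form 1 v) :=
      Submodule.span_le.2 (range_subset_iff.2 hvX)
    exact this hv
  ext i
  rw [form_one, Finset.sum_eq_zero_iff_of_nonneg fun i _ => mul_self_nonneg _] at h0
  simpa using h0 i (Finset.mem_univ i)

theorem orthogonalGroup_eq (d : ℕ) :
    (Matrix.orthogonalGroup (Fin d) ℝ : Set (Matrix (Fin d) (Fin d) ℝ)) =
      {A | A.transpose * 1 * A = 1} := by
  ext A
  rw [SetLike.mem_coe, Matrix.mem_orthogonalGroup_iff', mem_ofPred_eq, Matrix.mul_one]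

theorem form_one_self {d : ℕ} (x : Vec d) : form 1 x x = euclideanInv x ^ 2 := by
  rw [euclideanInv, EuclideanSpace.real_norm_sq_eq, form_one]
  simp only [sq]

theorem continuous_minkowskiInv (d : ℕ) : Continuous (minkowskiInv : Vec (d + 1) → ℝ) := by
  unfold minkowskiInv minkowski
  fun_prop

end GReps

end

theorem theorem2 (d n : ℕ) :
    -- the orthogonal group `O(d)` on `ℝ^d`
    (∀ h : (Fin n → GReps.Vec d) → GReps.Vec d,
      GReps.IsEquivariant (Matrix.orthogonalGroup (Fin d) ℝ : Set (Matrix (Fin d) (Fin d) ℝ)) h →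
        -- uniform approximation on compact sets
        (∀ K : Set (Fin n → GReps.Vec d), IsCompact K → ContinuousOn h K → ∀ ε : ℝ, 0 < ε →
          ∃ N : GReps.Model 0 n 0 1, ∀ X ∈ K, ‖N.toFun GReps.euclideanInv X - h X‖ < ε) ∧
        -- approximation in measure
        (Measurable h → ∀ (μ : MeasureTheory.Measure (Fin n → GReps.Vec d)),
          MeasureTheory.IsFiniteMeasure μ → ∀ ε : ℝ, 0 < ε →
          ∃ N : GReps.Model 0 n 0 1,
            μ {X | ε ≤ ‖N.toFun GReps.euclideanInv X - h X‖} < ENNReal.ofReal ε)) ∧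
    -- the Lorentz group `O(1, d)` on `ℝ^(1 + d)`
    (∀ h : (Fin n → GReps.Vec (d + 1)) → GReps.Vec (d + 1),
      GReps.IsEquivariant (GReps.lorentzGroup d) h →
        -- uniform approximation on compact sets
        (∀ K : Set (Fin n → GReps.Vec (d + 1)), IsCompact K →
          (∀ X ∈ K, GReps.NondegenerateSpan X) → ContinuousOn h K → ∀ ε : ℝ, 0 < ε →
          ∃ N : GReps.Model 0 n 0 1, ∀ X ∈ K, ‖N.toFun GReps.minkowskiInv X - h X‖ < ε) ∧
        -- approximation in measure
        (Measurable h → ∀ (μ : MeasureTheory.Measure (Fin n → GReps.Vec (d + 1))),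
          MeasureTheory.IsFiniteMeasure μ → (∀ᵐ X ∂μ, GReps.NondegenerateSpan X) →
          ∀ ε : ℝ, 0 < ε →
          ∃ N : GReps.Model 0 n 0 1,
            μ {X | ε ≤ ‖N.toFun GReps.minkowskiInv X - h X‖} < ENNReal.ofReal ε)) ∧
    -- Lebesgue-almost every configuration is admissible for the Lorentz group
    (∀ᵐ X : Fin n → GReps.Vec (d + 1), GReps.NondegenerateSpan X) := by
  refine ⟨fun h hh => ?_, fun h hh => ?_, ?_⟩
  · rw [GReps.orthogonalGroup_eq] at hh
    obtain ⟨h1, h2⟩ := GReps.approx_of_form Matrix.isSymm_one (inv := GReps.euclideanInv)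
      continuous_norm (φ := fun r => r ^ 2) GReps.form_one_self (by norm_num) hh
    exact ⟨fun K hK => h1 K hK fun X _ => GReps.nondegenerateOn_form_one X,
      fun hm μ hμ => h2 hm μ hμ (Filter.Eventually.of_forall GReps.nondegenerateOn_form_one)⟩
  · simp only [GReps.nondegenerateSpan_iff]
    exact GReps.approx_of_form (Matrix.isSymm_diagonal _) (GReps.continuous_minkowskiInv d)
      (φ := id) (fun x => GReps.form_eta x x) rfl hh
  · simp only [GReps.nondegenerateSpan_iff]
    exact GReps.ae_nondegenerateOn d n
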